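/- Let $\alpha>0$, $\lambda>1/\alpha$, $\beta>0$, $\overline\gamma>0$, and let $N,K\ge 1$ be integers (block-length and number of information bits). **Channel.** Let $\tau$ be Gamma distributed with density $\frac{\beta^\lambda}{\Gamma(\lambda)}\tau^{\lambda-1}e^{-\beta\tau}$ $(\tau>0)$; given $\tau$, let $X,Y$ be independent centred Gaussian variables of variance $\frac1{2\tau}$. Put $P=X^2+Y^2$, $H=P^{1/\alpha}$ (the $\alpha$-Lomax variable), and let the instantaneous signal-to-noise ratio be $\Gamma=\overline\gamma\,H/\mathbb E[H]$, with cumulative distribution function $F_\Gamma$. Put $$\zeta=\Big(\tfrac{\Gamma(1+1/\alpha)\,\Gamma(\lambda-1/\alpha)}{\Gamma(\lambda)}\Big)^{\alpha}.$$ **Linearised BLER.** Put $\eta=2^{K/N}-1$, $\delta=\sqrt{\tfrac{N}{2\pi}}\,(2^{2K/N}-1)^{-1/2}$, $\mu=\eta-\sqrt{\tfrac{\pi}{2\delta^2}}$, $\upsilon=\eta+\sqrt{\tfrac{\pi}{2\delta^2}}$, and assume $\mu\ge 0$. Let $$\mathsf{BLER}(\gamma)=\begin{cases}1,&\gamma\le\mu,\\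 \frac12-\frac{\delta}{\sqrt{2\pi}}(\gamma-\eta),&\mu<\gamma<\upsilon,\\ 0,&\gamma\ge\upsilon.\end{cases}$$ Then $\mathsf{BLER}(\Gamma)$ is integrable, $F_\Gamma(x)=1-\big(1+\frac{\zeta}{\overline\gamma^{\alpha}}x^\alpha\big)^{-\lambda}$ for all $x\ge0$, and the average BLER $\overline{\mathsf{BLER}}=\mathbb E[\mathsf{BLER}(\Gamma)]$ is $$\overline{\mathsf{BLER}}=F_\Gamma(\mu)-c_1\Big\{\upsilon^{\alpha+1}\Theta^{(1)}\!\Big(\tfrac{\zeta\upsilon^\alpha}{\overline\gamma^\alpha}\Big)-\mu^{\alpha+1}\Theta^{(1)}\!\Big(\tfrac{\zeta\mu^\alpha}{\overline\gamma^\alpha}\Big)\Big\}+c_2\Big\{\upsilon^{\alpha}\Theta^{(0)}\!\Big(\tfrac{\zeta\upsilon^\alpha}{\overline\gamma^\alpha}\Big)-\mu^{\alpha}\Theta^{(0)}\!\Big(\tfrac{\zeta\mu^\alpha}{\overline\gamma^\alpha}\Big)\Big\},$$ where $$c_1=\frac{\delta\alpha\lambda\zeta}{\sqrt{2\pi}\,(1+\alpha)\,\overline\gamma^\alpha},\qquad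 c_2=\Big(\frac12+\frac{\delta\eta}{\sqrt{2\pi}}\Big)\frac{\lambda\zeta}{\overline\gamma^\alpha},\qquad \Theta^{(p)}(x)={}_2F_1\Big(1+\lambda;\tfrac{p+\alpha}{\alpha};\tfrac{p+2\alpha}{\alpha};-x\Big),$$ and ${}_2F_1$ is the Gauss hypergeometric function (the hypergeometric series on the unit disc, continued analytically to $\mathbb C\setminus[1,\infty)$). -/

import Mathlib

open MeasureTheory ProbabilityTheory

noncomputable section

namespace AlphaLomax

/-! ### The Gauss hypergeometric function on its principal sheet -/

/-- The complex plane cut along the real half-line `[1, ∞)`. -/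
def cutPlane : Set ℂ := {z | ¬ (1 ≤ z.re ∧ z.im = 0)}

/-- `F` is the principal branch of `₂F₁(a; b; c; ·)`: it is holomorphic on the cut plane and is given
by the Gauss hypergeometric series on the open unit disc. -/
def IsPrincipalHypergeometric (a b c : ℂ) (F : ℂ → ℂ) : Prop :=
  DifferentiableOn ℂ F cutPlane ∧
    ∀ z : ℂ, ‖z‖ < 1 → F z = ordinaryHypergeometric a b c z

theorem isOpen_cutPlane : IsOpen cutPlane := by
  have h : cutPlane = {z : ℂ | 1 ≤ z.re}ᶜ ∪ {z : ℂ | z.im = 0}ᶜ := by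
    ext z
    simp only [cutPlane, Set.mem_ofPred_eq, Set.mem_union, Set.mem_compl_iff]
    tauto
  rw [h]
  exact (isClosed_le continuous_const Complex.continuous_re).isOpen_compl.union
    (isClosed_eq Complex.continuous_im continuous_const).isOpen_compl

theorem isPreconnected_cutPlane : IsPreconnected cutPlane := by
  have hne : (0 : ℂ) ∈ cutPlane := by simp [cutPlane]
  suffices h : StarConvex ℝ (0 : ℂ) cutPlane from
    (h.isPathConnected hne).isConnected.isPreconnected
  rw [starConvex_zero_iff]
  rintro z hz t ht0 ht1 ⟨h1, h2⟩
  simp only [Complex.real_smul, Complex.re_ofReal_mul, Complex.im_ofReal_mul] at h1 h2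
  have ht : t ≠ 0 := by
    rintro rfl
    norm_num at h1
  have him : z.im = 0 := (mul_eq_zero.mp h2).resolve_left ht
  refine hz ⟨?_, him⟩
  have htpos : 0 < t := lt_of_le_of_ne ht0 (Ne.symm ht)
  by_contra hlt
  nlinarith [mul_lt_mul_of_pos_left (not_le.mp hlt) htpos]

/-- The principal branch is unique on the cut plane. -/
theorem IsPrincipalHypergeometric.eqOn {a b c : ℂ} {F G : ℂ → ℂ}
    (hF : IsPrincipalHypergeometric a b c F) (hG : IsPrincipalHypergeometric a b c G) :
    Set.EqOn F G cutPlane := by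
  refine (hF.1.analyticOnNhd isOpen_cutPlane).eqOn_of_preconnected_of_eventuallyEq
    (hG.1.analyticOnNhd isOpen_cutPlane) isPreconnected_cutPlane
    (z₀ := 0) (by simp [cutPlane]) ?_
  filter_upwards [Metric.ball_mem_nhds (0 : ℂ) one_pos] with z hz
  rw [mem_ball_zero_iff] at hz
  rw [hF.2 z hz, hG.2 z hz]

open Classical in
/-- The Gauss hypergeometric function `₂F₁(a; b; c; z)`: the series on the unit disc, continued
analytically to the cut plane. -/
def gaussHypergeometric (a b c z : ℂ) : ℂ :=
  if h : ∃ F : ℂ → ℂ, IsPrincipalHypergeometric a b c F then Classical.choose h z else 0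

/-! ### The `α`-Lomax fading channel -/

/-- Law of the power `P = X² + Y²`, where `τ` is Gamma distributed with shape `lam` and rate `β` and,
given `τ`, the variables `X` and `Y` are independent centred Gaussians of variance `1 / (2 τ)`.
Here `X = N₁ / √(2 τ)` and `Y = N₂ / √(2 τ)` with `τ, N₁, N₂` independent and `N₁, N₂` standard
Gaussian. -/
def powerLaw (lam β : ℝ) : Measure ℝ :=
  ((gammaMeasure lam β).prod ((gaussianReal 0 1).prod (gaussianReal 0 1))).map
    fun w : ℝ × ℝ × ℝ => (w.2.1 / √(2 * w.1)) ^ 2 + (w.2.2 / √(2 * w.1)) ^ 2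

/-- The `α`-Lomax law: the law of `H = P ^ (1 / α)`. -/
def alphaLomaxLaw (α lam β : ℝ) : Measure ℝ :=
  (powerLaw lam β).map fun p => p ^ (1 / α)

/-- Law of the instantaneous SNR `γ̄ · H / 𝔼[H]`, with average SNR `gbar = γ̄`. -/
def snrLaw (α lam β gbar : ℝ) : Measure ℝ :=
  (alphaLomaxLaw α lam β).map fun h => gbar * (h / ∫ t, t ∂(alphaLomaxLaw α lam β))

/-- `ζ = (Γ(1 + 1/α) Γ(λ - 1/α) / Γ(λ)) ^ α`. -/
def zeta (α lam : ℝ) : ℝ :=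
  (Real.Gamma (1 + 1 / α) * Real.Gamma (lam - 1 / α) / Real.Gamma lam) ^ α

/-! ### Short-packet communication: block-length `N`, `K` information bits -/

/-- `η = 2 ^ (K / N) - 1`. -/
def eta (N K : ℕ) : ℝ := (2 : ℝ) ^ ((K : ℝ) / N) - 1

/-- `δ = √(N / (2 π)) (2 ^ (2 K / N) - 1) ^ (-1 / 2)`. -/
def delta (N K : ℕ) : ℝ :=
  √((N : ℝ) / (2 * Real.pi)) * ((2 : ℝ) ^ (2 * (K : ℝ) / N) - 1) ^ (-(1 / 2) : ℝ)

/-- `μ = η - √(π / (2 δ²))`. -/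
def muThr (N K : ℕ) : ℝ := eta N K - √(Real.pi / (2 * delta N K ^ 2))

/-- `υ = η + √(π / (2 δ²))`. -/
def upsThr (N K : ℕ) : ℝ := eta N K + √(Real.pi / (2 * delta N K ^ 2))

/-- The linearised block error rate at instantaneous SNR `g`. -/
def linBLER (N K : ℕ) (g : ℝ) : ℝ :=
  if g ≤ muThr N K then 1
  else if g < upsThr N K then 1 / 2 - delta N K / √(2 * Real.pi) * (g - eta N K)
  else 0

/-- The average BLER over the fading channel. -/
def avgBLER (α lam β gbar : ℝ) (N K : ℕ) : ℝ :=
  ∫ g, linBLER N K g ∂(snrLaw α lam β gbar)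

/-! ### Constants and functions of the closed form -/

/-- `c₁ = δ α λ ζ / (√(2 π) (1 + α) γ̄ ^ α)`. -/
def c1 (α lam gbar : ℝ) (N K : ℕ) : ℝ :=
  delta N K * α * lam * zeta α lam / (√(2 * Real.pi) * (1 + α) * gbar ^ α)

/-- `c₂ = (1 / 2 + δ η / √(2 π)) λ ζ / γ̄ ^ α`. -/
def c2 (α lam gbar : ℝ) (N K : ℕ) : ℝ :=
  (1 / 2 + delta N K * eta N K / √(2 * Real.pi)) * (lam * zeta α lam / gbar ^ α)

/-- `Θ^{(p)}(x) = ₂F₁(1 + λ; (p + α) / α; (p + 2 α) / α; -x)`. -/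
def Theta (α lam : ℝ) (p : ℕ) (x : ℝ) : ℂ :=
  gaussHypergeometric (1 + lam) ((p + α) / α) ((p + 2 * α) / α) (-x)

end AlphaLomax

end

namespace AlphaLomax

/-! ### Euler's integral for the principal branch -/

/-! Write k = δ/√(2π). The linearised BLER is a ramp of slope -k with k(υ - μ) = 1, hence equals k
∫_μ^υ 1{g ≤ x} dx. By Fubini its mean is k ∫_μ^υ F_Γ (`integral_linear_ramp`).

The distribution function is explicit (`cdf_snrLaw`). Half the squared norm of a standard planar
Gaussian is a unit exponential E, so P = E/τ with E independent of τ. Given τ, P exceeds y with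
probability exp(-τy), and the Laplace transform of the Gamma law turns this into (1 + y/β)^(-λ).
Since 𝔼[H]^α = βζ, the rate β disappears after normalisation.

With c = ζ/γ̄^α, integration by parts (`integral_one_sub_one_add_rpow`) leaves F_Γ(μ) and integrals
of x^(q-1) (1 + c x^α)^(-(1+λ)) over [μ, υ], with q = α and q = 1 + α. The substitution s = (x/u)^q
turns such an integral over [0, u] into u^q/q times Euler's integral ∫₀¹ (1 - z s^(1/b))^(-a) ds,
where a = 1 + λ, b = q/α and z = -c u^α. That integral is ₂F₁(a; b; b + 1; z): it is holomorphic on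
the cut plane and has the right series on the disc, and the principal branch is unique
(`gaussHypergeometric_eq_integral`). -/

theorem ascPochhammer_eval_mul_add_one {b : ℂ} (n : ℕ) :
    b * (ascPochhammer ℂ n).eval (b + 1) = (ascPochhammer ℂ n).eval b * (b + n) := by
  rw [← ascPochhammer_succ_eval, ascPochhammer_succ_left]
  simp

theorem ascPochhammer_eval_ne_zero {b : ℝ} (hb : 0 < b) (n : ℕ) :
    (ascPochhammer ℂ n).eval (b : ℂ) ≠ 0 := by
  rw [Ne, ascPochhammer_eval_eq_zero_iff]
  rintro ⟨k, -, hk⟩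
  have h := congrArg Complex.re hk
  simp at h
  have : (0 : ℝ) ≤ k := k.cast_nonneg
  linarith

theorem hasSum_one_sub_cpow_neg (a : ℂ) {w : ℂ} (hw : ‖w‖ < 1) :
    HasSum (fun n : ℕ => ((n.factorial : ℂ)⁻¹ * (ascPochhammer ℂ n).eval a) * w ^ n)
      ((1 - w) ^ (-a)) := by
  have h := (Complex.one_add_cpow_hasFPowerSeriesOnBall_zero (a := -a)).hasSum
    (y := -w) (by
      rw [← ENNReal.ofReal_one, Metric.eball_ofReal]
      simpa using hw)
  rw [zero_add, ← sub_eq_add_neg] at h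
  refine h.congr_fun ?_
  intro n
  -- The binomial series is ₂F₁ with equal second and third parameters, whose Pochhammer symbols
  -- cancel. The common value 1 is arbitrary among those with no vanishing symbol.
  rw [binomialSeries_eq_ordinaryHypergeometricSeries (b := (1 : ℂ))
    (fun k hk => by
      have := congrArg Complex.re hk
      simp at this
      have : (0 : ℝ) ≤ k := k.cast_nonneg
      linarith)]
  have h1 := ascPochhammer_eval_ne_zero one_pos n
  rw [Complex.ofReal_one] at h1
  simp only [FormalMultilinearSeries.compContinuousLinearMap_apply, neg_neg]
  have : (⇑(-(ContinuousLinearMap.id ℂ ℂ)) ∘ fun _ : Fin n => -w) = fun _ => w := by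
    ext; simp
  rw [this, ordinaryHypergeometricSeries_apply_eq, smul_eq_mul, mul_assoc _ (Polynomial.eval 1 _),
    mul_inv_cancel₀ h1, mul_one]

/-- Otherwise zt is real and at least 1, and 0 < t ≤ 1 then puts z itself on the cut. This keeps the
principal power in Euler's integrand holomorphic in z. -/
theorem one_sub_mul_mem_slitPlane {z : ℂ} (hz : z ∈ cutPlane) {t : ℝ} (ht0 : 0 ≤ t)
    (ht1 : t ≤ 1) : 1 - z * t ∈ Complex.slitPlane := by
  rw [Complex.mem_slitPlane_iff]
  by_contra! h
  obtain ⟨h1, h2⟩ := h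
  simp at h1 h2
  have ht : t ≠ 0 := by rintro rfl; norm_num at h1
  have htpos : 0 < t := lt_of_le_of_ne ht0 (Ne.symm ht)
  refine hz ⟨?_, h2.resolve_right ht⟩
  by_contra hlt
  nlinarith [mul_lt_mul_of_pos_left (not_le.mp hlt) htpos]

/-- The integrand of Euler's integral for `₂F₁(a; b; b + 1; z)`, after the substitution that
absorbs the power weight. -/
noncomputable def eulerIntegrand (a : ℂ) (b : ℝ) (z : ℂ) (s : ℝ) : ℂ :=
  (1 - z * (s ^ (1 / b) : ℝ)) ^ (-a)

theorem continuousOn_eulerIntegrand_uncurry (a : ℂ) {b : ℝ} (hb : 0 < b) :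
    ContinuousOn (fun q : ℂ × ℝ => eulerIntegrand a b q.1 q.2)
      (cutPlane ×ˢ Set.Icc (0 : ℝ) 1) := by
  have hc : Continuous fun q : ℂ × ℝ => (1 - q.1 * ((q.2 ^ (1 / b) : ℝ) : ℂ)) := by
    have : Continuous fun s : ℝ => s ^ (1 / b) := Real.continuous_rpow_const (by positivity)
    fun_prop
  refine hc.continuousOn.cpow continuousOn_const ?_
  rintro ⟨z, s⟩ ⟨hz, hs⟩
  exact one_sub_mul_mem_slitPlane hz (Real.rpow_nonneg hs.1 _)
    (Real.rpow_le_one hs.1 hs.2 (by positivity))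

theorem continuousOn_eulerIntegrand (a : ℂ) {b : ℝ} (hb : 0 < b) {z : ℂ} (hz : z ∈ cutPlane) :
    ContinuousOn (eulerIntegrand a b z) (Set.Icc (0 : ℝ) 1) :=
  (continuousOn_eulerIntegrand_uncurry a hb).comp (f := fun s : ℝ => (z, s))
    (by fun_prop) (fun _ hs => ⟨hz, hs⟩)

theorem hasDerivAt_eulerIntegrand (a : ℂ) {b : ℝ} (hb : 0 < b) {z : ℂ} (hz : z ∈ cutPlane)
    {s : ℝ} (hs : s ∈ Set.Icc (0 : ℝ) 1) :
    HasDerivAt (fun w => eulerIntegrand a b w s)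
      (a * eulerIntegrand (a + 1) b z s * (s ^ (1 / b) : ℝ)) z := by
  have h1 : HasDerivAt (fun w : ℂ => 1 - w * ((s ^ (1 / b) : ℝ) : ℂ))
      (-((s ^ (1 / b) : ℝ) : ℂ)) z := by
    simpa using ((hasDerivAt_id z).mul_const ((s ^ (1 / b) : ℝ) : ℂ)).const_sub 1
  have h2 := h1.cpow_const (c := -a) (one_sub_mul_mem_slitPlane hz (Real.rpow_nonneg hs.1 _)
    (Real.rpow_le_one hs.1 hs.2 (by positivity)))
  refine HasDerivAt.congr_deriv h2 ?_
  simp only [eulerIntegrand, neg_add']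
  ring

/-- Differentiation under the integral sign. A constant dominates, because the z-derivative is
jointly continuous on a closed ball times [0, 1], which is compact. -/
theorem differentiableOn_integral_eulerIntegrand (a : ℂ) {b : ℝ} (hb : 0 < b) :
    DifferentiableOn ℂ (fun z => ∫ s in (0 : ℝ)..1, eulerIntegrand a b z s) cutPlane := by
  intro z₀ hz₀
  obtain ⟨r, hr, hsub⟩ := Metric.nhds_basis_closedBall.mem_iff.mp (isOpen_cutPlane.mem_nhds hz₀)
  have hI : Set.uIoc (0 : ℝ) 1 ⊆ Set.Icc 0 1 := by
    rw [Set.uIoc_of_le zero_le_one]; exact Set.Ioc_subset_Icc_self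
  have hpow : Continuous fun s : ℝ => ((s ^ (1 / b) : ℝ) : ℂ) :=
    Complex.continuous_ofReal.comp (Real.continuous_rpow_const (by positivity))
  have hcd : ContinuousOn (fun q : ℂ × ℝ =>
      a * eulerIntegrand (a + 1) b q.1 q.2 * ((q.2 ^ (1 / b) : ℝ) : ℂ))
      (cutPlane ×ˢ Set.Icc (0 : ℝ) 1) :=
    (continuousOn_const.mul (continuousOn_eulerIntegrand_uncurry (a + 1) hb)).mul
      (hpow.comp continuous_snd).continuousOn
  obtain ⟨C, hC⟩ := ((isCompact_closedBall z₀ r).prod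
    (isCompact_Icc (a := (0 : ℝ)) (b := 1))).exists_bound_of_continuousOn
    (hcd.mono (Set.prod_mono hsub subset_rfl))
  have hmeas : ∀ z ∈ cutPlane, AEStronglyMeasurable (eulerIntegrand a b z)
      (volume.restrict (Set.uIoc (0 : ℝ) 1)) := fun z hz =>
    ((continuousOn_eulerIntegrand a hb hz).mono hI).aestronglyMeasurable measurableSet_uIoc
  refine (intervalIntegral.hasDerivAt_integral_of_dominated_loc_of_deriv_le
    (F' := fun z s => a * eulerIntegrand (a + 1) b z s * ((s ^ (1 / b) : ℝ) : ℂ))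
    (bound := fun _ => C) (Metric.closedBall_mem_nhds z₀ hr) ?_ ?_ ?_ ?_ ?_
    ?_).2.differentiableAt.differentiableWithinAt
  · filter_upwards [isOpen_cutPlane.mem_nhds hz₀] with z hz using hmeas z hz
  · refine ContinuousOn.intervalIntegrable ?_
    rw [Set.uIcc_of_le zero_le_one]
    exact continuousOn_eulerIntegrand a hb hz₀
  · refine (hcd.comp (f := fun s : ℝ => (z₀, s)) (by fun_prop)
      (fun s hs => ⟨hz₀, hI hs⟩)).aestronglyMeasurable measurableSet_uIoc
  · exact Filter.Eventually.of_forall fun s hs z hz => hC (z, s) ⟨hz, hI hs⟩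
  · exact intervalIntegrable_const
  · exact Filter.Eventually.of_forall fun s hs z hz =>
      hasDerivAt_eulerIntegrand a hb (hsub hz) (hI hs)

/-- Termwise integration of the binomial series: ∫₀¹ s^(n/b) ds = b/(b + n), which is the ratio
(b)_n/(b + 1)_n. -/
theorem integral_eulerIntegrand_eq_ordinaryHypergeometric (a : ℂ) {b : ℝ} (hb : 0 < b) {z : ℂ}
    (hz : ‖z‖ < 1) :
    ∫ s in (0 : ℝ)..1, eulerIntegrand a b z s = ordinaryHypergeometric a (b : ℂ) (b + 1) z := by
  have hI : Set.uIoc (0 : ℝ) 1 ⊆ Set.Icc 0 1 := by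
    rw [Set.uIoc_of_le zero_le_one]; exact Set.Ioc_subset_Icc_self
  have hpow : Continuous fun s : ℝ => ((s ^ (1 / b) : ℝ) : ℂ) :=
    Complex.continuous_ofReal.comp (Real.continuous_rpow_const (by positivity))
  have hle : ∀ s ∈ Set.Icc (0 : ℝ) 1, ‖((s ^ (1 / b) : ℝ) : ℂ)‖ ≤ 1 := by
    intro s hs
    rw [Complex.norm_real, Real.norm_of_nonneg (Real.rpow_nonneg hs.1 _)]
    exact Real.rpow_le_one hs.1 hs.2 (by positivity)
  have hle' : ∀ s ∈ Set.Icc (0 : ℝ) 1, ‖z * ((s ^ (1 / b) : ℝ) : ℂ)‖ ≤ ‖z‖ := by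
    intro s hs
    rw [norm_mul]
    exact mul_le_of_le_one_right (norm_nonneg _) (hle s hs)
  have key := intervalIntegral.hasSum_integral_of_dominated_convergence (μ := volume)
    (a := 0) (b := 1)
    (F := fun (n : ℕ) (s : ℝ) => ((n.factorial : ℂ)⁻¹ * (ascPochhammer ℂ n).eval a) *
      (z * ((s ^ (1 / b) : ℝ) : ℂ)) ^ n)
    (f := eulerIntegrand a b z)
    (fun n _ => ‖((n.factorial : ℂ)⁻¹ * (ascPochhammer ℂ n).eval a) * z ^ n‖)
    (fun n => (by fun_prop : Continuous _).aestronglyMeasurable)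
    (fun n => Filter.Eventually.of_forall fun s hs => by
      rw [norm_mul, norm_mul _ (z ^ n), norm_pow, norm_pow]
      gcongr
      exact hle' s (hI hs))
    (Filter.Eventually.of_forall fun s _ => (hasSum_one_sub_cpow_neg a hz).summable.norm)
    intervalIntegrable_const
    (Filter.Eventually.of_forall fun s hs =>
      hasSum_one_sub_cpow_neg a ((hle' s (hI hs)).trans_lt hz))
  rw [ordinaryHypergeometric_eq_tsum]
  refine (key.tsum_eq.symm).trans (tsum_congr fun n => ?_)
  have hint : ∫ s in (0 : ℝ)..1, ((s ^ (1 / b) : ℝ) : ℂ) ^ n = b / (b + n) := by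
    have : ∀ s ∈ Set.uIcc (0 : ℝ) 1, ((s ^ (1 / b) : ℝ) : ℂ) ^ n = ((s ^ (n / b : ℝ) : ℝ) : ℂ) := by
      intro s hs
      rw [Set.uIcc_of_le zero_le_one] at hs
      rw [← Complex.ofReal_pow, ← Real.rpow_mul_natCast hs.1]
      congr 2
      ring
    have hnb : (0 : ℝ) ≤ n / b := by positivity
    rw [intervalIntegral.integral_congr this, intervalIntegral.integral_ofReal,
      integral_rpow (Or.inl (by linarith)), Real.one_rpow,
      Real.zero_rpow (by positivity), sub_zero]
    have h1 : (b : ℂ) ≠ 0 := by exact_mod_cast hb.ne'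
    have h2 : (b : ℂ) + n ≠ 0 := by exact_mod_cast (by positivity : b + n ≠ 0)
    have h3 : (n : ℂ) + b ≠ 0 := by rwa [add_comm]
    push_cast
    field_simp
    ring
  simp only [mul_pow, ← mul_assoc]
  rw [intervalIntegral.integral_const_mul, hint, smul_eq_mul]
  have h1 : (ascPochhammer ℂ n).eval ((b : ℂ) + 1) ≠ 0 := by
    exact_mod_cast ascPochhammer_eval_ne_zero (by positivity : 0 < b + 1) n
  have h2 : (b : ℂ) + n ≠ 0 := by exact_mod_cast (by positivity : b + n ≠ 0)
  have h3 : (b : ℂ) / (b + n) =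
      (ascPochhammer ℂ n).eval (b : ℂ) * ((ascPochhammer ℂ n).eval ((b : ℂ) + 1))⁻¹ := by
    rw [div_eq_iff h2, mul_right_comm, ← ascPochhammer_eval_mul_add_one, mul_assoc,
      mul_inv_cancel₀ h1, mul_one]
  rw [h3]
  ring

theorem gaussHypergeometric_eq_integral (a : ℂ) {b : ℝ} (hb : 0 < b) {z : ℂ}
    (hz : z ∈ cutPlane) :
    gaussHypergeometric a b (b + 1) z = ∫ s in (0 : ℝ)..1, eulerIntegrand a b z s := by
  have h : IsPrincipalHypergeometric a b (b + 1)
      (fun z => ∫ s in (0 : ℝ)..1, eulerIntegrand a b z s) :=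
    ⟨differentiableOn_integral_eulerIntegrand a hb,
      fun _ => integral_eulerIntegrand_eq_ordinaryHypergeometric a hb⟩
  have hex : ∃ F, IsPrincipalHypergeometric a b (b + 1) F := ⟨_, h⟩
  rw [gaussHypergeometric, dif_pos hex]
  exact (Classical.choose_spec hex).eqOn h hz

theorem Theta_eq_integral {α lam : ℝ} (hα : 0 < α) (p : ℕ) {x : ℝ} (hx : 0 ≤ x) :
    Theta α lam p x = ((∫ s in (0 : ℝ)..1,
      (1 + x * s ^ (α / (p + α))) ^ (-(1 + lam)) : ℝ) : ℂ) := by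
  have hb : 0 < (p + α) / α := by positivity
  have hα' : (α : ℂ) ≠ 0 := by exact_mod_cast hα.ne'
  have hz : (-x : ℂ) ∈ cutPlane := by
    rintro ⟨h, -⟩
    simp at h
    linarith
  have := gaussHypergeometric_eq_integral (1 + lam) hb hz
  rw [Theta, show ((p : ℂ) + 2 * α) / α = ((p : ℂ) + α) / α + 1 by field_simp; ring]
  push_cast at this
  rw [this, ← intervalIntegral.integral_ofReal]
  refine intervalIntegral.integral_congr fun s hs => ?_
  rw [Set.uIcc_of_le zero_le_one] at hs
  have h0 : 0 ≤ s ^ (α / (p + α)) := Real.rpow_nonneg hs.1 _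
  have h1 : 0 ≤ 1 + x * s ^ (α / (p + α)) := by positivity
  simp only [eulerIntegrand, one_div_div]
  rw [Complex.ofReal_cpow h1]
  push_cast
  ring_nf

/-! ### The law of the channel -/

open Real Set in
/-- Half the squared norm of a standard Gaussian vector of the plane is exponential. -/
theorem map_gaussianReal_prod_half_sq :
    ((gaussianReal 0 1).prod (gaussianReal 0 1)).map
      (fun v : ℝ × ℝ => (v.1 ^ 2 + v.2 ^ 2) / 2) = expMeasure 1 := by
  have hm : Measurable fun v : ℝ × ℝ => (v.1 ^ 2 + v.2 ^ 2) / 2 := by fun_prop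
  ext S hS
  have hE : expMeasure 1 S = ∫⁻ u in Ioi (0 : ℝ),
      S.indicator (fun u => ENNReal.ofReal (exp (-u))) u := by
    have : expMeasure 1 S = ∫⁻ u in S, exponentialPDF 1 u := withDensity_apply _ hS
    rw [this, ← lintegral_indicator hS, ← lintegral_indicator measurableSet_Ioi]
    refine lintegral_congr_ae ?_
    filter_upwards [Measure.ae_ne volume (0 : ℝ)] with u hu
    rcases lt_or_gt_of_ne hu with h | h
    · rw [indicator_of_notMem (s := Ioi 0) (notMem_Ioi.mpr h.le)]
      by_cases hS' : u ∈ S <;> simp [hS', exponentialPDF_of_neg h]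
    · rw [indicator_of_mem (s := Ioi 0) (mem_Ioi.mpr h)]
      by_cases hS' : u ∈ S <;> simp [hS', exponentialPDF_of_nonneg h.le]
  have himg : (fun r : ℝ => r ^ 2 / 2) '' Ioi 0 = Ioi 0 := by
    ext u
    constructor
    · rintro ⟨r, hr, rfl⟩
      have : (0 : ℝ) < r := hr
      exact mem_Ioi.mpr (by positivity)
    · intro hu
      have hu' : (0 : ℝ) < u := hu
      refine ⟨√(2 * u), mem_Ioi.mpr (by positivity), ?_⟩
      simp only
      rw [sq_sqrt (by positivity)]
      ring
  have hinj : InjOn (fun r : ℝ => r ^ 2 / 2) (Ioi 0) := by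
    intro r hr t ht h
    have hr' : (0 : ℝ) < r := hr
    have ht' : (0 : ℝ) < t := ht
    have h' : r ^ 2 = t ^ 2 := by simpa using h
    exact (pow_left_inj₀ hr'.le ht'.le two_ne_zero).mp h'
  -- With u = r²/2, du = r dr is exactly the radial part of the polar area element.
  have hcv := lintegral_image_eq_lintegral_abs_deriv_mul (s := Ioi (0 : ℝ))
    (f := fun r : ℝ => r ^ 2 / 2) (f' := fun r => r) measurableSet_Ioi
    (fun r _ => by
      have := ((hasDerivAt_pow 2 r).div_const 2).hasDerivWithinAt (s := Ioi 0)
      simpa using this) hinj (S.indicator fun u => ENNReal.ofReal (exp (-u)))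
  rw [himg] at hcv
  rw [hE, hcv, Measure.map_apply hm hS, gaussianReal_of_var_ne_zero 0 one_ne_zero,
    prod_withDensity (measurable_gaussianPDF _ _) (measurable_gaussianPDF _ _),
    withDensity_apply _ (hm hS), ← lintegral_indicator (hm hS), ← Measure.volume_eq_prod,
    ← lintegral_comp_polarCoord_symm]
  have htarget : polarCoord.target = Ioi (0 : ℝ) ×ˢ Ioo (-π) π := rfl
  have hpt : ∀ p ∈ polarCoord.target, ENNReal.ofReal p.1 •
      ((fun v : ℝ × ℝ => (v.1 ^ 2 + v.2 ^ 2) / 2) ⁻¹' S).indicator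
        (fun z : ℝ × ℝ => gaussianPDF 0 1 z.1 * gaussianPDF 0 1 z.2) (polarCoord.symm p) =
      (ENNReal.ofReal |p.1| * S.indicator (fun u => ENNReal.ofReal (exp (-u))) (p.1 ^ 2 / 2)) *
        ENNReal.ofReal ((2 * π)⁻¹) := by
    intro p hp
    have hp1 : 0 < p.1 := hp.1
    have hsq : ((polarCoord.symm p).1 ^ 2 + (polarCoord.symm p).2 ^ 2) = p.1 ^ 2 := by
      simp only [polarCoord_symm_apply]
      nlinarith [sin_sq_add_cos_sq p.2]
    rw [abs_of_pos hp1, smul_eq_mul, mul_assoc]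
    congr 1
    by_cases hS' : p.1 ^ 2 / 2 ∈ S
    · rw [indicator_of_mem hS', indicator_of_mem (by simpa only [mem_preimage, hsq] using hS'),
        gaussianPDF, gaussianPDF, ← ENNReal.ofReal_mul (gaussianPDFReal_nonneg _ _ _),
        ← ENNReal.ofReal_mul (exp_pos _).le]
      congr 1
      have h2 : (√(2 * π))⁻¹ * (√(2 * π))⁻¹ = (2 * π)⁻¹ := by
        rw [← mul_inv, mul_self_sqrt (by positivity)]
      simp only [gaussianPDFReal, NNReal.coe_one, mul_one, sub_zero]
      rw [mul_mul_mul_comm, h2, ← exp_add, ← hsq, mul_comm]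
      congr 2
      ring
    · rw [indicator_of_notMem hS', zero_mul, indicator_of_notMem
        (by simpa only [mem_preimage, hsq] using hS')]
  rw [setLIntegral_congr_fun polarCoord.open_target.measurableSet hpt, htarget,
    Measure.volume_eq_prod, ← Measure.prod_restrict,
    lintegral_prod_mul (μ := volume.restrict (Ioi (0 : ℝ))) (ν := volume.restrict (Ioo (-π) π))
      (f := fun r => ENNReal.ofReal |r| *
        S.indicator (fun u => ENNReal.ofReal (exp (-u))) (r ^ 2 / 2))
      (g := fun _ => ENNReal.ofReal ((2 * π)⁻¹))]
  · rw [lintegral_const, Measure.restrict_apply_univ, Real.volume_Ioo,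
      ← ENNReal.ofReal_mul (by positivity), show (2 * π)⁻¹ * (π - -π) = 1 by field_simp; ring,
      ENNReal.ofReal_one, mul_one]
  · have : Measurable (S.indicator fun u : ℝ => ENNReal.ofReal (exp (-u))) :=
      Measurable.indicator (by fun_prop) hS
    exact Measurable.aemeasurable (by fun_prop)
  · fun_prop

theorem ae_pos_gammaMeasure (a r : ℝ) : ∀ᵐ t ∂(gammaMeasure a r), 0 < t := by
  rw [gammaMeasure, ae_withDensity_iff (by unfold gammaPDF; fun_prop)]
  filter_upwards [Measure.ae_ne volume (0 : ℝ)] with t ht h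
  by_contra hlt
  exact h (gammaPDF_of_neg (lt_of_le_of_ne (not_lt.mp hlt) ht))

theorem integral_gammaMeasure {a r : ℝ} (ha : 0 < a) (hr : 0 < r) (g : ℝ → ℝ) :
    ∫ t, g t ∂(gammaMeasure a r) = r ^ a / Real.Gamma a *
      ∫ t in Set.Ioi (0 : ℝ), t ^ (a - 1) * Real.exp (-(r * t)) * g t := by
  rw [gammaMeasure, integral_withDensity_eq_integral_toReal_smul
    (by unfold gammaPDF; fun_prop) (by simp [gammaPDF]), ← integral_const_mul,
    ← integral_indicator measurableSet_Ioi]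
  refine integral_congr_ae ?_
  filter_upwards [Measure.ae_ne volume (0 : ℝ)] with t ht
  rw [gammaPDF, ENNReal.toReal_ofReal (gammaPDFReal_nonneg ha hr t), gammaPDFReal, smul_eq_mul]
  rcases lt_or_gt_of_ne ht with h | h
  · simp [h.not_ge, h.le]
  · rw [if_pos h.le, Set.indicator_of_mem (Set.mem_Ioi.mpr h)]
    ring

theorem integral_rpow_gammaMeasure {a r s : ℝ} (ha : 0 < a) (hr : 0 < r) (hs : 0 < a + s) :
    ∫ t, t ^ s ∂(gammaMeasure a r) = Real.Gamma (a + s) / (Real.Gamma a * r ^ s) := by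
  rw [integral_gammaMeasure ha hr]
  have : ∀ t ∈ Set.Ioi (0 : ℝ), t ^ (a - 1) * Real.exp (-(r * t)) * t ^ s =
      t ^ (a + s - 1) * Real.exp (-(r * t)) := by
    intro t ht
    rw [mul_right_comm, ← Real.rpow_add ht]
    ring_nf
  rw [setIntegral_congr_fun measurableSet_Ioi this,
    Real.integral_rpow_mul_exp_neg_mul_Ioi hs hr, one_div, Real.inv_rpow hr.le,
    Real.rpow_add hr]
  have := (Real.Gamma_pos_of_pos ha).ne'
  have := (Real.rpow_pos_of_pos hr a).ne'
  have := (Real.rpow_pos_of_pos hr s).ne'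
  field_simp

theorem integral_exp_neg_mul_gammaMeasure {a r y : ℝ} (ha : 0 < a) (hr : 0 < r) (hy : 0 ≤ y) :
    ∫ t, Real.exp (-(t * y)) ∂(gammaMeasure a r) = (1 + y / r) ^ (-a) := by
  rw [integral_gammaMeasure ha hr]
  have : ∀ t ∈ Set.Ioi (0 : ℝ), t ^ (a - 1) * Real.exp (-(r * t)) * Real.exp (-(t * y)) =
      t ^ (a - 1) * Real.exp (-((r + y) * t)) := by
    intro t ht
    rw [mul_assoc, ← Real.exp_add]
    ring_nf
  rw [setIntegral_congr_fun measurableSet_Ioi this,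
    Real.integral_rpow_mul_exp_neg_mul_Ioi ha (by positivity),
    show 1 + y / r = (r + y) / r by field_simp,
    Real.rpow_neg (by positivity), Real.div_rpow (by positivity) hr.le,
    Real.div_rpow zero_le_one (by positivity), Real.one_rpow]
  have := (Real.Gamma_pos_of_pos ha).ne'
  have := (Real.rpow_pos_of_pos hr a).ne'
  have := (Real.rpow_pos_of_pos (by positivity : 0 < r + y) a).ne'
  field_simp

variable {α lam β gbar : ℝ}

/-- Factoring 1/(2τ) out of both squares leaves (N₁² + N₂²)/2, a unit exponential, over τ. -/
theorem powerLaw_eq (hlam : 0 < lam) (hβ : 0 < β) :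
    powerLaw lam β = ((gammaMeasure lam β).prod (expMeasure 1)).map fun w => w.2 / w.1 := by
  have := isProbabilityMeasure_gammaMeasure hlam hβ
  have hm : Measurable fun v : ℝ × ℝ => (v.1 ^ 2 + v.2 ^ 2) / 2 := by fun_prop
  conv_rhs => rw [← Measure.map_id (μ := gammaMeasure lam β), ← map_gaussianReal_prod_half_sq,
    Measure.map_prod_map _ _ measurable_id hm,
    Measure.map_map (by fun_prop) (by fun_prop)]
  refine Measure.map_congr ?_
  have hae : ∀ᵐ w ∂((gammaMeasure lam β).prod ((gaussianReal 0 1).prod (gaussianReal 0 1))),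
      0 < w.1 := Measure.quasiMeasurePreserving_fst.ae (ae_pos_gammaMeasure lam β)
  filter_upwards [hae] with w hw
  simp only [Function.comp_apply, Prod.map, id_eq, div_pow]
  rw [Real.sq_sqrt (by positivity)]
  field_simp

theorem isProbabilityMeasure_powerLaw (hlam : 0 < lam) (hβ : 0 < β) :
    IsProbabilityMeasure (powerLaw lam β) := by
  have := isProbabilityMeasure_gammaMeasure hlam hβ
  exact Measure.isProbabilityMeasure_map (by fun_prop)

theorem isProbabilityMeasure_snrLaw (hlam : 0 < lam) (hβ : 0 < β) :
    IsProbabilityMeasure (snrLaw α lam β gbar) := by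
  have := isProbabilityMeasure_powerLaw hlam hβ
  have : IsProbabilityMeasure (alphaLomaxLaw α lam β) :=
    Measure.isProbabilityMeasure_map (by fun_prop)
  exact Measure.isProbabilityMeasure_map (by fun_prop)

theorem ae_pos_powerLaw (hlam : 0 < lam) (hβ : 0 < β) : ∀ᵐ p ∂(powerLaw lam β), 0 < p := by
  have := isProbabilityMeasure_gammaMeasure hlam hβ
  have := isProbabilityMeasure_expMeasure one_pos
  rw [powerLaw_eq hlam hβ, ae_map_iff (by fun_prop) measurableSet_Ioi]
  have h1 : ∀ᵐ w ∂((gammaMeasure lam β).prod (expMeasure 1)), 0 < w.1 :=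
    Measure.quasiMeasurePreserving_fst.ae (ae_pos_gammaMeasure lam β)
  have h2 : ∀ᵐ w ∂((gammaMeasure lam β).prod (expMeasure 1)), 0 < w.2 :=
    -- The unit exponential law is by definition the Gamma law with shape and rate 1.
    Measure.quasiMeasurePreserving_snd.ae (ae_pos_gammaMeasure 1 1)
  filter_upwards [h1, h2] with w hw1 hw2 using div_pos hw2 hw1

/-- By independence the mean factors as 𝔼[τ^(-1/α)] 𝔼[E^(1/α)], two Gamma moments; the first is
where λ > 1/α enters. -/
theorem integral_alphaLomaxLaw (hα : 0 < α) (hlam : 1 / α < lam) (hβ : 0 < β) :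
    ∫ t, t ∂(alphaLomaxLaw α lam β) =
      β ^ (1 / α) * (Real.Gamma (1 + 1 / α) * Real.Gamma (lam - 1 / α) / Real.Gamma lam) := by
  have hs : 0 < 1 / α := by positivity
  have hl : 0 < lam := hs.trans hlam
  have := isProbabilityMeasure_gammaMeasure hl hβ
  have := isProbabilityMeasure_expMeasure one_pos
  rw [alphaLomaxLaw, integral_map (by fun_prop) (by fun_prop), powerLaw_eq hl hβ,
    integral_map (by fun_prop) (Measurable.aestronglyMeasurable (by fun_prop))]
  have h1 : ∀ᵐ w ∂((gammaMeasure lam β).prod (expMeasure 1)), 0 < w.1 :=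
    Measure.quasiMeasurePreserving_fst.ae (ae_pos_gammaMeasure lam β)
  have h2 : ∀ᵐ w ∂((gammaMeasure lam β).prod (expMeasure 1)), 0 < w.2 :=
    Measure.quasiMeasurePreserving_snd.ae (ae_pos_gammaMeasure 1 1)
  have h3 : (fun w : ℝ × ℝ => (w.2 / w.1) ^ (1 / α)) =ᵐ[(gammaMeasure lam β).prod (expMeasure 1)]
      fun w => w.1 ^ (-(1 / α)) * w.2 ^ (1 / α) := by
    filter_upwards [h1, h2] with w hw1 hw2
    rw [Real.div_rpow hw2.le hw1.le, Real.rpow_neg hw1.le]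
    ring
  rw [integral_congr_ae h3, integral_prod_mul (fun t : ℝ => t ^ (-(1 / α)))
    (fun e : ℝ => e ^ (1 / α)), expMeasure, integral_rpow_gammaMeasure hl hβ (by linarith),
    integral_rpow_gammaMeasure one_pos one_pos (by linarith), Real.Gamma_one, Real.one_rpow,
    Real.rpow_neg hβ.le]
  have := (Real.rpow_pos_of_pos hβ (1 / α)).ne'
  field_simp
  ring_nf

theorem powerLaw_real_Iic (hlam : 0 < lam) (hβ : 0 < β) {y : ℝ} (hy : 0 ≤ y) :
    (powerLaw lam β).real (Set.Iic y) = 1 - (1 + y / β) ^ (-lam) := by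
  have := isProbabilityMeasure_gammaMeasure hlam hβ
  have := isProbabilityMeasure_expMeasure one_pos
  have hmq : Measurable fun w : ℝ × ℝ => w.2 / w.1 := by fun_prop
  have hint : Integrable (fun t : ℝ => Real.exp (-(t * y))) (gammaMeasure lam β) := by
    refine Integrable.of_bound (C := 1) (by fun_prop) ?_
    filter_upwards [ae_pos_gammaMeasure lam β] with t ht
    rw [Real.norm_of_nonneg (Real.exp_pos _).le, Real.exp_le_one_iff]
    have := mul_nonneg ht.le hy
    linarith
  have hnn : 0 ≤ᵐ[gammaMeasure lam β] fun t => 1 - Real.exp (-(t * y)) := by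
    filter_upwards [ae_pos_gammaMeasure lam β] with t ht
    have := mul_nonneg ht.le hy
    simpa using this
  have key : powerLaw lam β (Set.Iic y) =
      ENNReal.ofReal (∫ t, (1 - Real.exp (-(t * y))) ∂(gammaMeasure lam β)) := by
    rw [powerLaw_eq hlam hβ, Measure.map_apply hmq measurableSet_Iic,
      Measure.prod_apply (hmq measurableSet_Iic)]
    refine Eq.trans ?_
      (ofReal_integral_eq_lintegral_ofReal ((integrable_const _).sub hint) hnn).symm
    refine lintegral_congr_ae ?_
    filter_upwards [ae_pos_gammaMeasure lam β] with t ht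
    have hset : Prod.mk t ⁻¹' ((fun w : ℝ × ℝ => w.2 / w.1) ⁻¹' Set.Iic y) = Set.Iic (t * y) := by
      ext e
      simp only [Set.mem_preimage, Set.mem_Iic]
      rw [div_le_iff₀ ht, mul_comm]
    rw [hset, ← ofReal_cdf, cdf_expMeasure_eq one_pos, if_pos (mul_nonneg ht.le hy), one_mul]
    rfl
  rw [measureReal_def, key, ENNReal.toReal_ofReal (integral_nonneg_of_ae hnn),
    integral_sub (integrable_const _) hint, integral_exp_neg_mul_gammaMeasure hlam hβ hy]
  simp

theorem zeta_pos (hα : 0 < α) (hlam : 1 / α < lam) : 0 < zeta α lam := by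
  have hs : 0 < 1 / α := by positivity
  have := Real.Gamma_pos_of_pos (by linarith : 0 < 1 + 1 / α)
  have := Real.Gamma_pos_of_pos (by linarith : 0 < lam - 1 / α)
  have := Real.Gamma_pos_of_pos (by linarith : 0 < lam)
  exact Real.rpow_pos_of_pos (by positivity) _

theorem cdf_snrLaw (hα : 0 < α) (hlam : 1 / α < lam) (hβ : 0 < β) (hgbar : 0 < gbar) {x : ℝ}
    (hx : 0 ≤ x) :
    cdf (snrLaw α lam β gbar) x = 1 - (1 + zeta α lam / gbar ^ α * x ^ α) ^ (-lam) := by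
  have hs : 0 < 1 / α := by positivity
  have hl : 0 < lam := hs.trans hlam
  have := isProbabilityMeasure_powerLaw hl hβ
  have : IsProbabilityMeasure (snrLaw α lam β gbar) := isProbabilityMeasure_snrLaw hl hβ
  have hG : 0 < Real.Gamma (1 + 1 / α) * Real.Gamma (lam - 1 / α) / Real.Gamma lam := by
    have := Real.Gamma_pos_of_pos (by linarith : 0 < 1 + 1 / α)
    have := Real.Gamma_pos_of_pos (by linarith : 0 < lam - 1 / α)
    have := Real.Gamma_pos_of_pos hl
    positivity
  set m := ∫ t, t ∂(alphaLomaxLaw α lam β) with hm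
  have hm' := integral_alphaLomaxLaw hα hlam hβ
  rw [← hm] at hm'
  have hmpos : 0 < m := by rw [hm']; positivity
  -- This β cancels the one in (1 + y/β)^(-λ), so the SNR law does not depend on β.
  have hmα : m ^ α = β * zeta α lam := by
    rw [hm', Real.mul_rpow (by positivity) hG.le, ← Real.rpow_mul hβ.le,
      one_div_mul_cancel hα.ne', Real.rpow_one, zeta]
  have hy : 0 ≤ x * m / gbar := by positivity
  have hset : (snrLaw α lam β gbar) (Set.Iic x) =
      (powerLaw lam β) (Set.Iic ((x * m / gbar) ^ α)) := by
    rw [snrLaw, alphaLomaxLaw, Measure.map_map (by fun_prop) (by fun_prop),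
      Measure.map_apply (by fun_prop) measurableSet_Iic]
    refine measure_congr ?_
    filter_upwards [ae_pos_powerLaw hl hβ] with p hp
    refine propext ?_
    change gbar * (p ^ (1 / α) / m) ≤ x ↔ p ≤ (x * m / gbar) ^ α
    rw [← Real.rpow_inv_le_iff_of_pos hp.le hy hα, ← one_div, le_div_iff₀ hgbar,
      ← mul_div_assoc, div_le_iff₀ hmpos, mul_comm gbar]
  rw [cdf_eq_real, measureReal_def, hset, ← measureReal_def,
    powerLaw_real_Iic hl hβ (by positivity), Real.div_rpow (by positivity) hgbar.le,
    Real.mul_rpow hx hmpos.le, hmα]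
  congr 3
  field_simp

/-! ### The partial moments of the Lomax-type density -/

theorem intervalIntegrable_rpow_mul_one_add {c q : ℝ} (hα : 0 < α) (hc : 0 ≤ c) (hq : 0 < q)
    (e : ℝ) {a b : ℝ} (ha : 0 ≤ a) (hb : 0 ≤ b) :
    IntervalIntegrable (fun x => x ^ (q - 1) * (1 + c * x ^ α) ^ e) volume a b := by
  refine (intervalIntegral.intervalIntegrable_rpow' (by linarith)).mul_continuousOn ?_
  refine ContinuousOn.rpow_const ?_ ?_
  · exact (continuous_const.add (continuous_const.mul
      (Real.continuous_rpow_const hα.le))).continuousOn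
  · intro x hx
    have hx0 : 0 ≤ x := (le_min ha hb).trans hx.1
    left
    positivity

theorem integral_rpow_mul_one_add {c q u : ℝ} (hα : 0 < α) (hc : 0 ≤ c) (hq : 0 < q)
    (hu : 0 ≤ u) (e : ℝ) :
    ∫ x in (0 : ℝ)..u, x ^ (q - 1) * (1 + c * x ^ α) ^ e =
      u ^ q / q * ∫ s in (0 : ℝ)..1, (1 + c * u ^ α * s ^ (α / q)) ^ e := by
  rcases hu.eq_or_lt with rfl | hu
  · simp [Real.zero_rpow hq.ne']
  have huq : 0 < u ^ q := Real.rpow_pos_of_pos hu q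
  have hg : ContinuousOn (fun s : ℝ => (1 + c * u ^ α * s ^ (α / q)) ^ e) (Set.Ici 0) := by
    refine ContinuousOn.rpow_const ?_ ?_
    · exact (continuous_const.add (continuous_const.mul
        (Real.continuous_rpow_const (by positivity)))).continuousOn
    · intro s hs
      have hs0 : (0 : ℝ) ≤ s := hs
      left
      positivity
  have hf : Continuous fun x : ℝ => x ^ q / u ^ q :=
    (Real.continuous_rpow_const hq.le).div_const _
  have hmaps : ∀ x, 0 ≤ x → 0 ≤ x ^ q / u ^ q := fun x hx => by positivity
  have hcomp : ∀ x, 0 ≤ x → (1 + c * u ^ α * (x ^ q / u ^ q) ^ (α / q)) ^ e =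
      (1 + c * x ^ α) ^ e := by
    intro x hx
    rw [Real.div_rpow (by positivity) (by positivity), ← Real.rpow_mul hx, ← Real.rpow_mul hu.le,
      mul_div_cancel₀ _ hq.ne']
    congr 2
    have := (Real.rpow_pos_of_pos hu α).ne'
    field_simp
  have hImg : (fun x : ℝ => x ^ q / u ^ q) '' Set.uIcc 0 u ⊆ Set.Ici 0 := by
    rintro _ ⟨x, hx, rfl⟩
    rw [Set.uIcc_of_le hu.le] at hx
    exact hmaps x hx.1
  have hcongr : ∀ x ∈ Set.uIcc 0 u,
      ((fun s : ℝ => (1 + c * u ^ α * s ^ (α / q)) ^ e) ∘ fun x => x ^ q / u ^ q) x *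
        (q * x ^ (q - 1) / u ^ q) = q / u ^ q * (x ^ (q - 1) * (1 + c * x ^ α) ^ e) := by
    intro x hx
    rw [Set.uIcc_of_le hu.le] at hx
    simp only [Function.comp_apply]
    rw [hcomp x hx.1]
    ring
  -- This form asks for the derivative only in the open interval: for q < 1 the map x^q is not
  -- differentiable at 0.
  have key := intervalIntegral.integral_comp_mul_deriv''' (a := 0) (b := u)
    (f := fun x : ℝ => x ^ q / u ^ q) (f' := fun x => q * x ^ (q - 1) / u ^ q)
    (g := fun s : ℝ => (1 + c * u ^ α * s ^ (α / q)) ^ e) hf.continuousOn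
    (fun x hx => by
      rw [min_eq_left hu.le] at hx
      exact ((Real.hasDerivAt_rpow_const (Or.inl hx.1.ne')).div_const _).hasDerivWithinAt)
    (hg.mono ((Set.image_mono (Set.Ioo_subset_Icc_self)).trans hImg))
    ((hg.mono hImg).integrableOn_compact (isCompact_uIcc.image hf))
    (by
      rw [integrableOn_congr_fun hcongr measurableSet_uIcc, Set.uIcc_of_le hu.le,
        integrableOn_Icc_iff_integrableOn_Ioc, ← intervalIntegrable_iff_integrableOn_Ioc_of_le hu.le]
      exact (intervalIntegrable_rpow_mul_one_add hα hc hq e le_rfl hu.le).const_mul _)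
  rw [intervalIntegral.integral_congr hcongr, intervalIntegral.integral_const_mul] at key
  simp only [Real.zero_rpow hq.ne', zero_div, div_self huq.ne'] at key
  rw [← key]
  field_simp

theorem integral_rpow_mul_eq_Theta {c u : ℝ} (hα : 0 < α) (hc : 0 ≤ c) (hu : 0 ≤ u) (p : ℕ) :
    ((∫ x in (0 : ℝ)..u, x ^ (p + α - 1) * (1 + c * x ^ α) ^ (-(1 + lam)) : ℝ) : ℂ) =
      ((u ^ (p + α) / (p + α) : ℝ) : ℂ) * Theta α lam p (c * u ^ α) := by
  rw [integral_rpow_mul_one_add hα hc (by positivity : 0 < p + α) hu, Complex.ofReal_mul,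
    Theta_eq_integral hα p (by positivity : 0 ≤ c * u ^ α)]

/-! ### Averages of a truncated linear function -/

/-- The function that is `1` up to `m`, `0` from `u` on, and linear of slope `-k` in between has
mean `k` times the integral of the distribution function. -/
theorem integral_linear_ramp (P : Measure ℝ) [IsProbabilityMeasure P] {m u k : ℝ} (hmu : m ≤ u)
    (hk : k * (u - m) = 1) {L : ℝ → ℝ} (h1 : ∀ g ≤ m, L g = 1)
    (h2 : ∀ g, m < g → g < u → L g = k * (u - g)) (h3 : ∀ g, u ≤ g → m < g → L g = 0) :
    ∫ g, L g ∂P = k * ∫ x in m..u, cdf P x := by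
  -- The integral is the length of [g, ∞) ∩ (m, u]: all of u - m below the ramp, u - g on it, and 0
  -- beyond.
  have hL : ∀ g, L g = k * ∫ x in m..u, (Set.Iic x).indicator (fun _ => (1 : ℝ)) g := by
    intro g
    have hind : ∀ x, (Set.Iic x).indicator (fun _ => (1 : ℝ)) g =
        (Set.Ici g).indicator (fun _ => (1 : ℝ)) x := fun x => by
      simp [Set.indicator_apply]
    simp_rw [hind]
    rw [intervalIntegral.integral_of_le hmu, integral_indicator measurableSet_Ici,
      Measure.restrict_restrict measurableSet_Ici, integral_const, smul_eq_mul, mul_one,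
      measureReal_restrict_apply_univ]
    rcases le_or_gt g m with hg | hg
    · rw [h1 g hg, show Set.Ici g ∩ Set.Ioc m u = Set.Ioc m u from
        Set.inter_eq_right.mpr fun x hx => (hg.trans hx.1.le), Real.volume_real_Ioc_of_le hmu, hk]
    · have : Set.Ici g ∩ Set.Ioc m u = Set.Icc g u := by
        ext x
        exact ⟨fun hx => ⟨hx.1, hx.2.2⟩, fun hx => ⟨hx.1, hg.trans_le hx.1, hx.2⟩⟩
      rw [this]
      rcases lt_or_ge g u with hgu | hgu
      · rw [h2 g hg hgu, Real.volume_real_Icc_of_le hgu.le]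
      · rw [h3 g hgu hg, Real.volume_real_Icc, max_eq_right (by linarith), mul_zero]
  simp_rw [hL]
  rw [integral_const_mul]
  congr 1
  rw [← intervalIntegral_integral_swap]
  · refine intervalIntegral.integral_congr fun x _ => ?_
    rw [integral_indicator measurableSet_Iic, integral_const, smul_eq_mul, mul_one,
      measureReal_restrict_apply_univ, cdf_eq_real]
  · have hmeas : MeasurableSet {q : ℝ × ℝ | q.2 ≤ q.1} :=
      measurableSet_le measurable_snd measurable_fst
    have hunc : Function.uncurry (fun x g : ℝ => (Set.Iic x).indicator (fun _ => (1 : ℝ)) g) =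
        {q : ℝ × ℝ | q.2 ≤ q.1}.indicator fun _ => 1 := by
      ext ⟨x, g⟩
      simp [Function.uncurry, Set.indicator_apply]
    have : IsFiniteMeasure (volume.restrict (Set.uIoc m u)) := by
      rw [Set.uIoc_of_le hmu]
      infer_instance
    rw [hunc]
    exact (integrable_const _).indicator hmeas

/-- Integration by parts with k(x - u) as primitive of k: it vanishes at u and equals -1 at m, so
the boundary term is exactly the distribution function at m. -/
theorem integral_one_sub_one_add_rpow {c k m u : ℝ} (hα : 0 < α) (hc : 0 ≤ c) (hm : 0 ≤ m)
    (hmu : m ≤ u) (hk : k * (u - m) = 1) :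
    k * ∫ x in m..u, (1 - (1 + c * x ^ α) ^ (-lam)) =
      (1 - (1 + c * m ^ α) ^ (-lam)) +
      lam * c * α * (k * u * (∫ x in m..u, x ^ (α - 1) * (1 + c * x ^ α) ^ (-(1 + lam))) -
        k * ∫ x in m..u, x ^ (1 + α - 1) * (1 + c * x ^ α) ^ (-(1 + lam))) := by
  have hu : 0 ≤ u := hm.trans hmu
  have hI0 := intervalIntegrable_rpow_mul_one_add hα hc hα (-(1 + lam)) hm hu
  have hI1 := intervalIntegrable_rpow_mul_one_add hα hc (by linarith : 0 < 1 + α)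
    (-(1 + lam)) hm hu
  have hnn : ∀ x ∈ Set.uIcc m u, 0 ≤ x := fun x hx => by
    rw [Set.uIcc_of_le hmu] at hx; exact hm.trans hx.1
  have hF : ContinuousOn (fun x : ℝ => 1 - (1 + c * x ^ α) ^ (-lam)) (Set.uIcc m u) := by
    refine continuousOn_const.sub (ContinuousOn.rpow_const ?_ ?_)
    · exact (continuous_const.add (continuous_const.mul
        (Real.continuous_rpow_const hα.le))).continuousOn
    · intro x hx
      have := hnn x hx
      left
      positivity
  have parts := intervalIntegral.integral_mul_deriv_eq_deriv_mul_of_hasDeriv_right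
    (a := m) (b := u) (u := fun x : ℝ => 1 - (1 + c * x ^ α) ^ (-lam))
    (u' := fun x => lam * c * α * (x ^ (α - 1) * (1 + c * x ^ α) ^ (-(1 + lam))))
    (v := fun x => k * (x - u)) (v' := fun _ => k) hF (by fun_prop)
    (fun x hx => by
      rw [min_eq_left hmu] at hx
      have hx0 : 0 < x := hm.trans_lt hx.1
      have hpos : 0 < 1 + c * x ^ α := by positivity
      have h1 := ((((Real.hasDerivAt_rpow_const (p := α) (Or.inl hx0.ne')).const_mul c).const_add
        1).rpow_const (p := -lam) (Or.inl hpos.ne')).const_sub 1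
      refine (h1.congr_deriv ?_).hasDerivWithinAt
      rw [show -lam - 1 = -(1 + lam) by ring]
      ring)
    (fun x _ => by
      simpa using (((hasDerivAt_id x).sub_const u).const_mul k).hasDerivWithinAt)
    (hI0.const_mul _) intervalIntegrable_const
  rw [intervalIntegral.integral_mul_const, mul_comm] at parts
  rw [parts]
  have hsplit : ∀ x ∈ Set.uIcc m u,
      lam * c * α * (x ^ (α - 1) * (1 + c * x ^ α) ^ (-(1 + lam))) * (k * (x - u)) =
      lam * c * α * k * (x ^ (1 + α - 1) * (1 + c * x ^ α) ^ (-(1 + lam))) -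
        lam * c * α * (k * u) * (x ^ (α - 1) * (1 + c * x ^ α) ^ (-(1 + lam))) := by
    intro x hx
    have hx' : x ^ (1 + α - 1) = x * x ^ (α - 1) := by
      rcases (hnn x hx).eq_or_lt with rfl | hx0
      · rw [zero_mul, Real.zero_rpow (by linarith)]
      · rw [show 1 + α - 1 = 1 + (α - 1) by ring, Real.rpow_add hx0, Real.rpow_one]
    rw [hx']
    ring
  rw [intervalIntegral.integral_congr hsplit,
    intervalIntegral.integral_sub (hI1.const_mul _) (hI0.const_mul _),
    intervalIntegral.integral_const_mul, intervalIntegral.integral_const_mul]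
  linear_combination (1 - (1 + c * m ^ α) ^ (-lam)) * hk

/-! ### The linearised block error rate -/

variable {N K : ℕ}

theorem delta_pos (hN : 0 < N) (hK : 0 < K) : 0 < delta N K := by
  have hN' : (0 : ℝ) < N := by exact_mod_cast hN
  have hK' : (0 : ℝ) < K := by exact_mod_cast hK
  have h1 : 1 < (2 : ℝ) ^ (2 * (K : ℝ) / N) :=
    Real.one_lt_rpow one_lt_two (by positivity)
  exact mul_pos (Real.sqrt_pos.mpr (div_pos hN' (by positivity)))
    (Real.rpow_pos_of_pos (by linarith) _)

/-- The ramp thus drops by 1/2 on each side of η, which makes it continuous at both thresholds and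
gives kυ = 1/2 + kη, the factor in c₂. -/
theorem slope_mul_halfWidth {d : ℝ} (hd : 0 < d) :
    d / √(2 * Real.pi) * √(Real.pi / (2 * d ^ 2)) = 1 / 2 := by
  have h : √(Real.pi / (2 * d ^ 2)) = √(2 * Real.pi) / (2 * d) := by
    rw [show Real.pi / (2 * d ^ 2) = 2 * Real.pi / (2 * d) ^ 2 by field_simp,
      Real.sqrt_div (by positivity), Real.sqrt_sq (by positivity)]
  have : √(2 * Real.pi) ≠ 0 := by positivity
  rw [h]
  field_simp

theorem linBLER_mem_Icc (hN : 0 < N) (hK : 0 < K) (g : ℝ) : linBLER N K g ∈ Set.Icc 0 1 := by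
  have hd := delta_pos hN hK
  have hw := slope_mul_halfWidth hd
  have hk : 0 < delta N K / √(2 * Real.pi) := by positivity
  unfold linBLER
  split_ifs with h1 h2
  · simp
  · unfold muThr at h1
    unfold upsThr at h2
    constructor <;> nlinarith
  · simp

theorem measurable_linBLER : Measurable (linBLER N K) := by
  unfold linBLER
  exact Measurable.ite measurableSet_Iic measurable_const
    (Measurable.ite measurableSet_Iio (by fun_prop) measurable_const)

theorem integrable_linBLER (hN : 0 < N) (hK : 0 < K) (P : Measure ℝ) [IsFiniteMeasure P] :
    Integrable (linBLER N K) P := by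
  refine Integrable.of_bound (C := 1) measurable_linBLER.aestronglyMeasurable ?_
  refine Filter.Eventually.of_forall fun g => ?_
  have := linBLER_mem_Icc hN hK g
  rw [Real.norm_of_nonneg this.1]
  exact this.2

theorem avgBLER_eq (hα : 0 < α) (hlam : 1 / α < lam) (hβ : 0 < β) (hgbar : 0 < gbar)
    (hN : 0 < N) (hK : 0 < K) (hμ : 0 ≤ muThr N K) :
    avgBLER α lam β gbar N K = cdf (snrLaw α lam β gbar) (muThr N K) +
      lam * (zeta α lam / gbar ^ α) * α *
      ((1 / 2 + delta N K * eta N K / √(2 * Real.pi)) *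
        (∫ x in muThr N K..upsThr N K,
          x ^ (α - 1) * (1 + zeta α lam / gbar ^ α * x ^ α) ^ (-(1 + lam))) -
      delta N K / √(2 * Real.pi) * ∫ x in muThr N K..upsThr N K,
          x ^ (1 + α - 1) * (1 + zeta α lam / gbar ^ α * x ^ α) ^ (-(1 + lam))) := by
  have hl : 0 < lam := lt_trans (by positivity) hlam
  have : IsProbabilityMeasure (snrLaw α lam β gbar) := isProbabilityMeasure_snrLaw hl hβ
  have hz := zeta_pos hα hlam
  have hw := slope_mul_halfWidth (delta_pos hN hK)
  have hsq : 0 ≤ √(Real.pi / (2 * delta N K ^ 2)) := Real.sqrt_nonneg _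
  have hmu : muThr N K ≤ upsThr N K := by unfold muThr upsThr; linarith
  have hk : delta N K / √(2 * Real.pi) * (upsThr N K - muThr N K) = 1 := by
    unfold muThr upsThr; linear_combination 2 * hw
  have hku : delta N K / √(2 * Real.pi) * upsThr N K =
      1 / 2 + delta N K * eta N K / √(2 * Real.pi) := by
    unfold upsThr; linear_combination hw
  rw [avgBLER, integral_linear_ramp (snrLaw α lam β gbar) hmu hk
    (fun g hg => by rw [linBLER, if_pos hg])
    (fun g hg hgu => by
      rw [linBLER, if_neg hg.not_ge, if_pos hgu]
      unfold upsThr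
      linear_combination -hw)
    (fun g hgu hg => by rw [linBLER, if_neg hg.not_ge, if_neg hgu.not_gt])]
  have hcdf : ∀ x ∈ Set.uIcc (muThr N K) (upsThr N K), cdf (snrLaw α lam β gbar) x =
      1 - (1 + zeta α lam / gbar ^ α * x ^ α) ^ (-lam) := fun x hx => by
    rw [Set.uIcc_of_le hmu] at hx
    exact cdf_snrLaw hα hlam hβ hgbar (hμ.trans hx.1)
  rw [intervalIntegral.integral_congr hcdf,
    integral_one_sub_one_add_rpow hα (by positivity) hμ hmu hk,
    cdf_snrLaw hα hlam hβ hgbar hμ, hku]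

end AlphaLomax

theorem mainTheorem7 (α lam β gbar : ℝ) (N K : ℕ)
    (hα : 0 < α) (hlam : 1 / α < lam) (hβ : 0 < β) (hgbar : 0 < gbar)
    (hN : 0 < N) (hK : 0 < K) (hμ : 0 ≤ AlphaLomax.muThr N K) :
    MeasureTheory.Integrable (AlphaLomax.linBLER N K) (AlphaLomax.snrLaw α lam β gbar) ∧
    (∀ x : ℝ, 0 ≤ x → ProbabilityTheory.cdf (AlphaLomax.snrLaw α lam β gbar) x =
      1 - (1 + AlphaLomax.zeta α lam / gbar ^ α * x ^ α) ^ (-lam)) ∧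
    (AlphaLomax.avgBLER α lam β gbar N K : ℂ) =
      (ProbabilityTheory.cdf (AlphaLomax.snrLaw α lam β gbar) (AlphaLomax.muThr N K) : ℝ)
      - (AlphaLomax.c1 α lam gbar N K : ℂ) *
        (((AlphaLomax.upsThr N K ^ (α + 1) : ℝ) : ℂ) *
            AlphaLomax.Theta α lam 1
              (AlphaLomax.zeta α lam * AlphaLomax.upsThr N K ^ α / gbar ^ α)
          - ((AlphaLomax.muThr N K ^ (α + 1) : ℝ) : ℂ) *
            AlphaLomax.Theta α lam 1
              (AlphaLomax.zeta α lam * AlphaLomax.muThr N K ^ α / gbar ^ α))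
      + (AlphaLomax.c2 α lam gbar N K : ℂ) *
        (((AlphaLomax.upsThr N K ^ α : ℝ) : ℂ) *
            AlphaLomax.Theta α lam 0
              (AlphaLomax.zeta α lam * AlphaLomax.upsThr N K ^ α / gbar ^ α)
          - ((AlphaLomax.muThr N K ^ α : ℝ) : ℂ) *
            AlphaLomax.Theta α lam 0
              (AlphaLomax.zeta α lam * AlphaLomax.muThr N K ^ α / gbar ^ α)) := by
  have hl : 0 < lam := lt_trans (by positivity) hlam
  have hP := AlphaLomax.isProbabilityMeasure_snrLaw (α := α) (gbar := gbar) hl hβ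
  refine ⟨AlphaLomax.integrable_linBLER hN hK _,
    fun x hx => AlphaLomax.cdf_snrLaw hα hlam hβ hgbar hx, ?_⟩
  have hc : 0 ≤ AlphaLomax.zeta α lam / gbar ^ α :=
    div_nonneg (AlphaLomax.zeta_pos hα hlam).le (by positivity)
  have hu : 0 ≤ AlphaLomax.upsThr N K := by
    have : 0 ≤ √(Real.pi / (2 * AlphaLomax.delta N K ^ 2)) := Real.sqrt_nonneg _
    unfold AlphaLomax.muThr at hμ
    unfold AlphaLomax.upsThr
    linarith
  have hsub : ∀ p : ℕ, (((∫ x in AlphaLomax.muThr N K..AlphaLomax.upsThr N K, x ^ (p + α - 1) *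
      (1 + AlphaLomax.zeta α lam / gbar ^ α * x ^ α) ^ (-(1 + lam)) : ℝ) : ℂ)) =
      ((AlphaLomax.upsThr N K ^ (p + α) / (p + α) : ℝ) : ℂ) * AlphaLomax.Theta α lam p
          (AlphaLomax.zeta α lam * AlphaLomax.upsThr N K ^ α / gbar ^ α) -
        ((AlphaLomax.muThr N K ^ (p + α) / (p + α) : ℝ) : ℂ) * AlphaLomax.Theta α lam p
          (AlphaLomax.zeta α lam * AlphaLomax.muThr N K ^ α / gbar ^ α) := by
    intro p
    have hi := fun b (hb : (0 : ℝ) ≤ b) => AlphaLomax.intervalIntegrable_rpow_mul_one_add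
      (q := p + α) hα hc (by positivity) (-(1 + lam)) le_rfl hb
    rw [← intervalIntegral.integral_interval_sub_left (hi _ hu) (hi _ hμ), Complex.ofReal_sub,
      AlphaLomax.integral_rpow_mul_eq_Theta hα hc hu, AlphaLomax.integral_rpow_mul_eq_Theta hα hc hμ,
      div_mul_eq_mul_div, div_mul_eq_mul_div]
  -- The density carries a factor α: the denominator p + α cancels it for p = 0 and makes it α/(1 +
  -- α) for p = 1, as in c₂ and c₁.
  have h0 := hsub 0
  have h1 := hsub 1
  simp only [Nat.cast_zero, Nat.cast_one, zero_add] at h0 h1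
  have hα' : (α : ℂ) ≠ 0 := by exact_mod_cast hα.ne'
  have h1α : (1 : ℂ) + α ≠ 0 := by exact_mod_cast (by positivity : 1 + α ≠ 0)
  have hg : ((gbar ^ α : ℝ) : ℂ) ≠ 0 := by
    exact_mod_cast (Real.rpow_pos_of_pos hgbar α).ne'
  have hpi : ((√(2 * Real.pi) : ℝ) : ℂ) ≠ 0 := by
    exact_mod_cast (by positivity : √(2 * Real.pi) ≠ 0)
  rw [AlphaLomax.avgBLER_eq hα hlam hβ hgbar hN hK hμ, AlphaLomax.c1, AlphaLomax.c2,
    add_comm α 1]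
  simp only [Complex.ofReal_add, Complex.ofReal_mul, Complex.ofReal_sub, Complex.ofReal_div,
    Complex.ofReal_one, Complex.ofReal_ofNat] at h0 h1 ⊢
  rw [h0, h1]
  field_simp
  ring
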